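/- (First logarithmic summation formulas.) Let $B_m$ denote the Bernoulli numbers, $\frac{x}{e^x-1}=\sum_{m\ge 0}\frac{B_m}{m!}x^m$, let $S_k^{(1)}(l)$ denote the (signed) Stirling numbers of the first kind, defined by $x(x+1)\cdots(x+k-1)=(-1)^k\sum_{l=0}^k(-1)^lS_k^{(1)}(l)x^l$, let $\zeta$ be the Riemann zeta function, and read $0\log 0$ as $0$. Then for every natural number $n\ge 1$ the two series below converge absolutely and $$\sum_{k=0}^{n}k\log k=\tfrac12n^2\log n-\tfrac14n^2+\tfrac12n\log n+\tfrac1{12}\log n+\tfrac1{12}-\zeta'(-1)+\sum_{k=1}^{\infty}\frac{c_k}{(n+1)(n+2)\cdots(n+k)},$$ where $c_k=(-1)^{k+1}\sum_{l=1}^{k}\frac{(-1)^l}{l(l+1)(l+2)}B_{l+2}S_k^{(1)}(l)$, and $$\sum_{k=0}^{n}k\log k=\tfrac12n^2\log n-\tfrac14n^2+\tfrac12n\log n+\tfrac1{12}\log n+\tfrac1{12}-\zeta'(-1)+\sum_{k=1}^{\infty}\frac{d_k}{n(n+1)(n+2)\cdots(n+k)},$$ where $d_k=(-1)^{k+1}\sum_{l=1}^{k}\frac{(-1)^l}{(l+1)(l+2)(l+3)}B_{l+3}S_k^{(1)}(l)$.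 The first coefficients are $c_1=0$, $c_2=\frac1{720}$, $c_3=\frac1{240}$, $c_4=\frac{19}{1260}$, $c_5=\frac{17}{252}$ and $d_1=\frac1{720}$, $d_2=\frac1{720}$, $d_3=\frac{13}{5040}$, $d_4=\frac1{140}$. -/

import Mathlib

/-- The (signed) Stirling numbers of the first kind `S_k^{(1)}(l)`; Mathlib's
`Nat.stirlingFirst` is the unsigned version. -/
def signedStirlingFirst (k l : ℕ) : ℤ :=
  (-1) ^ (k + l) * (Nat.stirlingFirst k l : ℤ)

theorem ascPochhammer_eval_eq_sum_stirlingFirst {R : Type*} [CommRing R] (k : ℕ) (x : R) :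
    (ascPochhammer R k).eval x =
      ∑ l ∈ Finset.range (k + 1), (Nat.stirlingFirst k l : R) * x ^ l := by
  induction k with
  | zero => simp
  | succ k ih =>
    rw [ascPochhammer_succ_eval, ih, Finset.sum_range_succ' _ (k + 1)]
    simp only [Nat.stirlingFirst_succ_succ, Nat.stirlingFirst_succ_zero, Nat.cast_add,
      Nat.cast_mul, add_mul, Finset.sum_add_distrib, Nat.cast_zero, zero_mul, add_zero]
    rw [mul_add, add_comm]
    congr 1
    · have h1 := Finset.sum_range_succ'
        (fun l => (k : R) * (Nat.stirlingFirst k l : R) * x ^ l) (k + 1)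
      rw [Finset.sum_range_succ,
        Nat.stirlingFirst_eq_zero_of_lt (Nat.lt_succ_self k)] at h1
      have h0 : (k : R) * (Nat.stirlingFirst k 0 : R) = 0 := by
        cases k <;> simp [Nat.stirlingFirst_succ_zero]
      rw [h0] at h1
      simp only [Nat.cast_zero, mul_zero, zero_mul, add_zero] at h1
      rw [← h1, Finset.sum_mul]
      exact Finset.sum_congr rfl fun l _ => by ring
    · rw [Finset.sum_mul]
      exact Finset.sum_congr rfl fun l _ => by ring

/-- The signed Stirling numbers of the first kind are the connecting coefficients in
`x (x + 1) ⋯ (x + k - 1) = (-1)^k ∑_{l = 0}^k (-1)^l S_k^{(1)}(l) x^l`. -/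
theorem ascPochhammer_eval_eq_sum_signedStirlingFirst {R : Type*} [CommRing R]
    (k : ℕ) (x : R) :
    (ascPochhammer R k).eval x =
      (-1) ^ k * ∑ l ∈ Finset.range (k + 1),
        (-1) ^ l * (signedStirlingFirst k l : R) * x ^ l := by
  rw [ascPochhammer_eval_eq_sum_stirlingFirst, Finset.mul_sum]
  refine Finset.sum_congr rfl fun l _ => ?_
  have h : ((-1 : R) ^ k * (-1) ^ l) * ((-1) ^ k * (-1) ^ l) = 1 := by
    rw [← pow_add, ← mul_pow]; simp
  simp only [signedStirlingFirst, Int.cast_mul, Int.cast_pow, Int.cast_neg, Int.cast_one,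
    Int.cast_natCast, pow_add]
  linear_combination (-(Nat.stirlingFirst k l : R) * x ^ l) * h

/-- The numerators
`(-1)^{k+1} ∑_{l=1}^k (-1)^l / (l (l+1) (l+2)) * B_{l+2} * S_k^{(1)}(l)`. -/
def logSumNumer₁ (k : ℕ) : ℚ :=
  (-1) ^ (k + 1) * ∑ l ∈ Finset.Icc 1 k,
    (-1) ^ l / ((l : ℚ) * (l + 1) * (l + 2)) * bernoulli (l + 2) * (signedStirlingFirst k l : ℚ)

/-- The numerators
`(-1)^{k+1} ∑_{l=1}^k (-1)^l / ((l+1) (l+2) (l+3)) * B_{l+3} * S_k^{(1)}(l)`. -/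
def logSumNumer₂ (k : ℕ) : ℚ :=
  (-1) ^ (k + 1) * ∑ l ∈ Finset.Icc 1 k,
    (-1) ^ l / (((l : ℚ) + 1) * (l + 2) * (l + 3)) * bernoulli (l + 3) *
      (signedStirlingFirst k l : ℚ)

/-- The `k`-th term of the first series: `logSumNumer₁ k / ((n+1) (n+2) ⋯ (n+k))`. -/
noncomputable def logSumTerm₁ (n k : ℕ) : ℝ :=
  (logSumNumer₁ k : ℝ) / ∏ j ∈ Finset.Icc 1 k, ((n : ℝ) + j)

/-- The `k`-th term of the second series: `logSumNumer₂ k / (n (n+1) (n+2) ⋯ (n+k))`. -/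
noncomputable def logSumTerm₂ (n k : ℕ) : ℝ :=
  (logSumNumer₂ k : ℝ) / ∏ j ∈ Finset.Icc 0 k, ((n : ℝ) + j)

/-- The elementary part
`n² log n / 2 - n² / 4 + n log n / 2 + log n / 12 + 1 / 12`. -/
noncomputable def logSumMain (n : ℕ) : ℝ :=
  1 / 2 * (n : ℝ) ^ 2 * Real.log n - 1 / 4 * (n : ℝ) ^ 2 + 1 / 2 * (n : ℝ) * Real.log n
    + 1 / 12 * Real.log n + 1 / 12

/-!
Write `x⁽ᵏ⁾ = x (x + 1) ⋯ (x + k - 1)`. The Euler-Maclaurin formula with kernel `B₂(t) / 2` turns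
one step of `∑ k log k` into the increment of the elementary part minus
`∫₀¹ B₂(t) / 2 · dt / (n + t)`. Reflecting `t ↦ 1 - t` and inserting Waring's expansion
`1 / (x - t) = ∑ t⁽ᵏ⁾ / x⁽ᵏ⁺¹⁾` at `x = n + 1` makes this integral a factorial series. The
functional `L` sending `X ^ l` to `B_{l+2} / (l (l+1) (l+2))` satisfies
`L (X · ΔF) = -∫₀¹ B₂(t) / 2 · F(t) dt`, and `X · Δ X⁽ᵏ⁾ = k X⁽ᵏ⁾`; hence the moments
`∫₀¹ B₂(t) / 2 · t⁽ᵏ⁾ dt` are `k c_k` with `c_k = -L X⁽ᵏ⁾`. These are exactly the numerators of the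
increment of `∑ c_k / x⁽ᵏ⁾` under `x ↦ x + 1`, so `∑ k log k` minus the elementary part and the
series does not depend on `n`. The second series is a summation by parts of the first, as
`d_k = c_{k+1} - k c_k`.

The constant is found by applying the same Euler-Maclaurin formula to `∑ k^{-s}`: the corrected
partial sums converge to `ζ s` locally uniformly for `-2 < re s`, `s ≠ 1`, so that they may be
differentiated at `s = -1`.
-/

open Filter Topology

section EulerMaclaurin

variable {E : Type*} [NormedAddCommGroup E] [NormedSpace ℝ E]

/-- The integral `∫₀¹ B_k(t) / k! • f(t) dt` against the normalised `k`-th Bernoulli polynomial: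
up to sign, the remainder of the Euler-Maclaurin formula of order `k` on the unit interval when
`f` is a `k`-th derivative. -/
noncomputable def bernoulliIntegral (k : ℕ) (f : ℝ → E) : E :=
  ∫ t in (0 : ℝ)..1, (bernoulliFun k t / k.factorial) • f t

theorem continuous_bernoulliFun_div_factorial (k : ℕ) :
    Continuous fun t => bernoulliFun k t / k.factorial :=
  (continuous_bernoulliFun k).div_const _

theorem hasDerivAt_bernoulliFun_div_factorial (k : ℕ) (t : ℝ) :
    HasDerivAt (fun t => bernoulliFun (k + 1) t / (k + 1).factorial)
      (bernoulliFun k t / k.factorial) t := by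
  refine ((hasDerivAt_bernoulliFun (k + 1) t).div_const _).congr_deriv ?_
  rw [Nat.add_sub_cancel, Nat.factorial_succ, Nat.cast_mul]
  exact mul_div_mul_left _ _ (Nat.cast_ne_zero.2 k.succ_ne_zero)

theorem bernoulliIntegral_add (k : ℕ) {f g : ℝ → E} (hf : Continuous f) (hg : Continuous g) :
    bernoulliIntegral k (fun t => f t + g t) = bernoulliIntegral k f + bernoulliIntegral k g := by
  have hB := continuous_bernoulliFun_div_factorial k
  simp only [bernoulliIntegral, smul_add]
  exact intervalIntegral.integral_add ((hB.smul hf).intervalIntegrable _ _)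
    ((hB.smul hg).intervalIntegrable _ _)

theorem bernoulliIntegral_smul (k : ℕ) (a : ℝ) (f : ℝ → E) :
    bernoulliIntegral k (fun t => a • f t) = a • bernoulliIntegral k f := by
  simp only [bernoulliIntegral, smul_comm _ a, intervalIntegral.integral_smul]

theorem hasSum_bernoulliIntegral (k : ℕ) {F : ℕ → ℝ → E} {f : ℝ → E} {bound : ℕ → ℝ}
    (hF : ∀ i, Continuous (F i)) (hsum : Summable bound)
    (hbound : ∀ i, ∀ t ∈ Set.Ioc (0 : ℝ) 1, ‖F i t‖ ≤ bound i)
    (hlim : ∀ t ∈ Set.Ioc (0 : ℝ) 1, HasSum (fun i => F i t) (f t)) :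
    HasSum (fun i => bernoulliIntegral k (F i)) (bernoulliIntegral k f) := by
  have hB := continuous_bernoulliFun_div_factorial k
  rw [← Set.uIoc_of_le (zero_le_one' ℝ)] at hbound hlim
  refine intervalIntegral.hasSum_integral_of_dominated_convergence
    (fun i t => ‖bernoulliFun k t / k.factorial‖ * bound i)
    (fun i => (hB.smul (hF i)).aestronglyMeasurable)
    (fun i => Eventually.of_forall fun t ht => ?_)
    (Eventually.of_forall fun t _ => hsum.mul_left _) ?_
    (Eventually.of_forall fun t ht => (hlim t ht).const_smul _)
  · rw [norm_smul]
    exact mul_le_mul_of_nonneg_left (hbound i t ht) (norm_nonneg _)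
  · simp only [tsum_mul_left]
    exact (hB.norm.mul_const _).intervalIntegrable _ _

theorem bernoulliIntegral_comp_one_sub (k : ℕ) (f : ℝ → E) :
    bernoulliIntegral k (fun t => f (1 - t)) = (-1 : ℝ) ^ k • bernoulliIntegral k f := by
  have h := intervalIntegral.integral_comp_sub_left (a := 0) (b := 1)
    (fun t => (bernoulliFun k (1 - t) / k.factorial) • f t) 1
  simp only [sub_sub_cancel, sub_self, sub_zero, bernoulliFun_eval_one_sub] at h
  rw [bernoulliIntegral, h, bernoulliIntegral, ← intervalIntegral.integral_smul]
  simp only [smul_smul, mul_div_assoc]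

theorem norm_bernoulliIntegral_le {k : ℕ} {f : ℝ → E} {B C : ℝ}
    (hB : ∀ t ∈ Set.Icc (0 : ℝ) 1, |bernoulliFun k t / k.factorial| ≤ B)
    (hC : ∀ t ∈ Set.Icc (0 : ℝ) 1, ‖f t‖ ≤ C) :
    ‖bernoulliIntegral k f‖ ≤ B * C := by
  have hbound : ∀ t ∈ Set.uIoc (0 : ℝ) 1, ‖(bernoulliFun k t / k.factorial) • f t‖ ≤ B * C := by
    intro t ht
    have ht' : t ∈ Set.Icc (0 : ℝ) 1 :=
      Set.Ioc_subset_Icc_self (Set.uIoc_of_le (zero_le_one' ℝ) ▸ ht)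
    rw [norm_smul, Real.norm_eq_abs]
    exact mul_le_mul (hB t ht') (hC t ht') (norm_nonneg _) ((abs_nonneg _).trans (hB t ht'))
  simpa [bernoulliIntegral] using intervalIntegral.norm_integral_le_of_norm_le_const hbound

theorem abs_bernoulliFun_two_div_le {t : ℝ} (ht : t ∈ Set.Icc (0 : ℝ) 1) :
    |bernoulliFun 2 t / (2 : ℕ).factorial| ≤ 1 := by
  rw [bernoulliFun_two, abs_le]
  norm_num
  constructor <;> nlinarith [ht.1, ht.2, mul_nonneg ht.1 (sub_nonneg.2 ht.2)]

theorem bernoulliFun_three (t : ℝ) : bernoulliFun 3 t = t * (t - 1 / 2) * (t - 1) := by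
  simp only [bernoulliFun, Polynomial.bernoulli_def, Finset.sum_range_succ]
  norm_num [Polynomial.aeval_def, bernoulli_two, bernoulli_eq_zero_of_odd]
  ring

theorem abs_bernoulliFun_three_div_le {t : ℝ} (ht : t ∈ Set.Icc (0 : ℝ) 1) :
    |bernoulliFun 3 t / (3 : ℕ).factorial| ≤ 1 := by
  have h0 : |t| ≤ 1 := abs_le.2 ⟨by linarith [ht.1], ht.2⟩
  have h1 : |t - 1 / 2| ≤ 1 := abs_le.2 ⟨by linarith [ht.1], by linarith [ht.2]⟩
  have h2 : |t - 1| ≤ 1 := abs_le.2 ⟨by linarith [ht.1], by linarith [ht.2]⟩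
  have h : |bernoulliFun 3 t| ≤ 1 := by
    rw [bernoulliFun_three, abs_mul, abs_mul]
    exact mul_le_one₀ (mul_le_one₀ h0 (abs_nonneg _) h1) (abs_nonneg _) h2
  rw [abs_div, Nat.abs_cast]
  exact div_le_one_of_le₀ (h.trans (by norm_num [Nat.factorial])) (Nat.cast_nonneg _)

variable [CompleteSpace E]

theorem bernoulliIntegral_zero {f f' : ℝ → E}
    (hf : ∀ t ∈ Set.Icc (0 : ℝ) 1, HasDerivAt f (f' t) t)
    (hf' : ContinuousOn f' (Set.Icc 0 1)) : bernoulliIntegral 0 f' = f 1 - f 0 := by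
  rw [← Set.uIcc_of_le zero_le_one] at hf hf'
  simp only [bernoulliIntegral, bernoulliFun_zero, Nat.factorial_zero, Nat.cast_one, div_one,
    one_smul]
  exact intervalIntegral.integral_eq_sub_of_hasDerivAt hf hf'.intervalIntegrable

theorem bernoulliIntegral_succ (k : ℕ) {f f' : ℝ → E}
    (hf : ∀ t ∈ Set.Icc (0 : ℝ) 1, HasDerivAt f (f' t) t)
    (hf' : ContinuousOn f' (Set.Icc 0 1)) :
    bernoulliIntegral (k + 1) f' = (bernoulliFun (k + 1) 1 / (k + 1).factorial) • f 1 -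
      (bernoulliFun (k + 1) 0 / (k + 1).factorial) • f 0 - bernoulliIntegral k f := by
  rw [← Set.uIcc_of_le zero_le_one] at hf hf'
  exact intervalIntegral.integral_smul_deriv_eq_deriv_smul
    (fun t _ => hasDerivAt_bernoulliFun_div_factorial k t) hf
    ((continuous_bernoulliFun_div_factorial k).intervalIntegrable _ _) hf'.intervalIntegrable

theorem bernoulliIntegral_three {h h' : ℝ → E}
    (hh : ∀ t ∈ Set.Icc (0 : ℝ) 1, HasDerivAt h (h' t) t)
    (hh' : ContinuousOn h' (Set.Icc 0 1)) :
    bernoulliIntegral 3 h' = -bernoulliIntegral 2 h := by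
  rw [bernoulliIntegral_succ 2 hh hh']
  norm_num [bernoulliFun_three]

theorem eulerMaclaurin_two {F f g h : ℝ → E}
    (hF : ∀ t ∈ Set.Icc (0 : ℝ) 1, HasDerivAt F (f t) t)
    (hf : ∀ t ∈ Set.Icc (0 : ℝ) 1, HasDerivAt f (g t) t)
    (hg : ∀ t ∈ Set.Icc (0 : ℝ) 1, HasDerivAt g (h t) t)
    (hh : ContinuousOn h (Set.Icc 0 1)) :
    f 1 = (F 1 + (1 / 2 : ℝ) • f 1 + (1 / 12 : ℝ) • g 1) -
      (F 0 + (1 / 2 : ℝ) • f 0 + (1 / 12 : ℝ) • g 0) - bernoulliIntegral 2 h := by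
  have hf' : ContinuousOn f (Set.Icc 0 1) := fun t ht => (hf t ht).continuousAt.continuousWithinAt
  have hg' : ContinuousOn g (Set.Icc 0 1) := fun t ht => (hg t ht).continuousAt.continuousWithinAt
  rw [bernoulliIntegral_succ 1 hg hh, bernoulliIntegral_succ 0 hf hg',
    bernoulliIntegral_zero hF hf']
  norm_num [bernoulliFun_one, bernoulliFun_two]
  module

end EulerMaclaurin

section RisingFactorial

theorem ascPochhammer_eval_eq_prod_range {R : Type*} [CommSemiring R] (k : ℕ) (x : R) :
    (ascPochhammer R k).eval x = ∏ j ∈ Finset.range k, (x + j) := by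
  induction k with
  | zero => simp
  | succ k ih => rw [ascPochhammer_succ_eval, ih, Finset.prod_range_succ]

theorem mul_ascPochhammer_eval_add_one {R : Type*} [CommSemiring R] (k : ℕ) (x : R) :
    x * (ascPochhammer R k).eval (x + 1) = (ascPochhammer R (k + 1)).eval x := by
  simp [ascPochhammer_succ_left]

theorem sum_ascPochhammer_div {K : Type*} [Field K] {x y : K} (hxy : x ≠ y)
    (hx : ∀ k, (ascPochhammer K k).eval x ≠ 0) (n : ℕ) :
    ∑ k ∈ Finset.range n, (ascPochhammer K k).eval y / (ascPochhammer K (k + 1)).eval x =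
      (1 - (ascPochhammer K n).eval y / (ascPochhammer K n).eval x) / (x - y) := by
  have hxy' : x - y ≠ 0 := sub_ne_zero.2 hxy
  induction n with
  | zero => simp
  | succ n ih =>
    have hn := hx n
    have hn' := hx (n + 1)
    rw [ascPochhammer_succ_eval] at hn'
    have hxn : x + n ≠ 0 := right_ne_zero_of_mul hn'
    rw [Finset.sum_range_succ, ih, ascPochhammer_succ_eval, ascPochhammer_succ_eval]
    field_simp
    ring

theorem ascPochhammer_eval_nonneg {S : Type*} [Semiring S] [PartialOrder S] [IsOrderedRing S]
    (k : ℕ) {y : S} (hy : 0 ≤ y) : 0 ≤ (ascPochhammer S k).eval y := by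
  induction k with
  | zero => simp
  | succ k ih =>
    rw [ascPochhammer_succ_eval]
    exact mul_nonneg ih (add_nonneg hy k.cast_nonneg)

theorem ascPochhammer_eval_le {S : Type*} [Semiring S] [PartialOrder S] [IsOrderedRing S]
    (k : ℕ) {x y : S} (hy : 0 ≤ y) (hyx : y ≤ x) :
    (ascPochhammer S k).eval y ≤ (ascPochhammer S k).eval x := by
  induction k with
  | zero => simp
  | succ k ih =>
    rw [ascPochhammer_succ_eval, ascPochhammer_succ_eval]
    exact mul_le_mul ih (add_le_add_left hyx _) (add_nonneg hy k.cast_nonneg)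
      (ascPochhammer_eval_nonneg k (hy.trans hyx))

theorem ascPochhammer_eval_eq_div_gammaSeq (x : ℝ) {n : ℕ} (hn : n ≠ 0) :
    (ascPochhammer ℝ (n + 1)).eval x = (n : ℝ) ^ x * n.factorial / Real.GammaSeq x n := by
  rw [Real.GammaSeq, ← ascPochhammer_eval_eq_prod_range, div_div_cancel₀ (by positivity)]

theorem tendsto_ascPochhammer_div {x y : ℝ} (hy : 0 < y) (hyx : y < x) :
    Tendsto (fun n => (ascPochhammer ℝ n).eval y / (ascPochhammer ℝ n).eval x) atTop (𝓝 0) := by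
  rw [← tendsto_add_atTop_iff_nat 1]
  have hpow : Tendsto (fun n : ℕ => (n : ℝ) ^ (-(x - y))) atTop (𝓝 0) :=
    (tendsto_rpow_neg_atTop (sub_pos.2 hyx)).comp tendsto_natCast_atTop_atTop
  have hlim := hpow.mul ((Real.GammaSeq_tendsto_Gamma x).div (Real.GammaSeq_tendsto_Gamma y)
    (Real.Gamma_pos_of_pos hy).ne')
  rw [zero_mul] at hlim
  refine hlim.congr' ?_
  filter_upwards [eventually_ne_atTop 0] with n hn
  have hn' : (0 : ℝ) < n := by positivity
  rw [ascPochhammer_eval_eq_div_gammaSeq y hn, ascPochhammer_eval_eq_div_gammaSeq x hn, neg_sub,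
    Real.rpow_sub hn']
  simp only [Pi.div_apply]
  field_simp

theorem hasSum_ascPochhammer_div {x y : ℝ} (hy : 0 < y) (hyx : y < x) :
    HasSum (fun k => (ascPochhammer ℝ k).eval y / (ascPochhammer ℝ (k + 1)).eval x)
      (1 / (x - y)) := by
  have hx : 0 < x := hy.trans hyx
  rw [hasSum_iff_tendsto_nat_of_nonneg fun k =>
    div_nonneg (ascPochhammer_eval_nonneg k hy.le) (ascPochhammer_eval_nonneg _ hx.le)]
  simp only [sum_ascPochhammer_div hyx.ne' fun k => (ascPochhammer_pos k x hx).ne']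
  simpa using ((tendsto_ascPochhammer_div hy hyx).const_sub 1).div_const (x - y)

theorem hasSum_factorial_div_ascPochhammer {x : ℝ} (hx : 1 < x) :
    HasSum (fun k : ℕ => (k.factorial : ℝ) / (ascPochhammer ℝ (k + 1)).eval x) (1 / (x - 1)) := by
  simpa only [ascPochhammer_eval_one] using hasSum_ascPochhammer_div zero_lt_one hx

end RisingFactorial

section Numerators

open Polynomial hiding bernoulli bernoulli_zero bernoulli_one sum_bernoulli

/-- The linear functional on polynomials with `X ^ l ↦ B_{l+2} / (l (l+1) (l+2))`, through which
the numerators of both series are rising factorials. Division by zero sends `1` to `0`, which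
matches the omission of `l = 0` in the definition of the numerators. -/
noncomputable def bernoulliFunctional : ℝ[X] →ₗ[ℝ] ℝ :=
  Polynomial.lsum fun l =>
    ((bernoulli (l + 2) : ℝ) / ((l : ℝ) * (l + 1) * (l + 2))) • LinearMap.id

theorem bernoulliFunctional_C_mul_X_pow (a : ℝ) (l : ℕ) :
    bernoulliFunctional (C a * X ^ l) =
      (bernoulli (l + 2) : ℝ) / ((l : ℝ) * (l + 1) * (l + 2)) * a := by
  rw [bernoulliFunctional, C_mul_X_pow_eq_monomial, lsum_apply, sum_monomial_index] <;> simp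

theorem bernoulliIntegral_two_pow (j : ℕ) :
    bernoulliIntegral 2 (fun y : ℝ => y ^ j) =
      1 / ((j + 1) * (j + 2) * (j + 3)) - 1 / 2 * (1 / ((j + 1) * (j + 2))) +
        1 / 12 * (1 / (j + 1)) := by
  have h := eulerMaclaurin_two
    (F := fun y : ℝ => y ^ (j + 3) / ((j + 1) * (j + 2) * (j + 3)))
    (f := fun y : ℝ => y ^ (j + 2) / ((j + 1) * (j + 2)))
    (g := fun y : ℝ => y ^ (j + 1) / (j + 1))
    (fun t _ => ((hasDerivAt_pow (j + 3) t).div_const _).congr_deriv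
      (by push_cast; field_simp))
    (fun t _ => ((hasDerivAt_pow (j + 2) t).div_const _).congr_deriv
      (by push_cast; field_simp))
    (fun t _ => ((hasDerivAt_pow (j + 1) t).div_const _).congr_deriv
      (by push_cast; field_simp))
    (continuous_pow j).continuousOn
  simp only [one_pow, ne_eq, Nat.add_eq_zero_iff, one_ne_zero, OfNat.ofNat_ne_zero, and_false,
    not_false_eq_true, zero_pow, zero_div, smul_eq_mul, mul_zero, add_zero, sub_zero] at h
  linear_combination h

theorem add_three_choose_mul (j i : ℕ) :
    (j + 3).choose (i + 3) * ((i + 1) * (i + 2) * (i + 3)) =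
      (j + 1) * (j + 2) * (j + 3) * j.choose i := by
  linear_combination -((j + 2) * (j + 3) * Nat.add_one_mul_choose_eq j i) -
    (j + 3) * (i + 1) * Nat.add_one_mul_choose_eq (j + 1) (i + 1) -
    (i + 1) * (i + 2) * Nat.add_one_mul_choose_eq (j + 2) (i + 2)

theorem sum_choose_mul_bernoulli (j : ℕ) :
    ∑ i ∈ Finset.range j, ((j + 3).choose (i + 3) : ℚ) * bernoulli (i + 3) =
      (j + 3) / 2 - (j + 3) * (j + 2) / 12 - 1 := by
  have h := sum_bernoulli (j + 3)
  have hchoose : ((j + 3).choose 2 : ℚ) = (j + 3) * (j + 2) / 2 := by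
    rw [Nat.cast_choose_two]
    push_cast
    ring
  rw [if_neg (by omega), Finset.sum_range_succ', Finset.sum_range_succ',
    Finset.sum_range_succ'] at h
  simp only [zero_add, Nat.choose_zero_right, Nat.choose_one_right, bernoulli_zero, bernoulli_one,
    bernoulli_two, hchoose, Nat.reduceAdd] at h
  push_cast at h
  linear_combination h

theorem bernoulliFunctional_X_mul_forwardDiff_X_pow (j : ℕ) :
    bernoulliFunctional (X * ((X + 1) ^ j - X ^ j)) = -bernoulliIntegral 2 fun y : ℝ => y ^ j := by
  have hexpand : (X * ((X + 1) ^ j - X ^ j) : ℝ[X]) =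
      ∑ i ∈ Finset.range j, C (j.choose i : ℝ) * X ^ (i + 1) := by
    rw [add_pow, Finset.sum_range_succ, Nat.choose_self, Nat.sub_self, pow_zero, mul_one,
      Nat.cast_one, mul_one, add_sub_cancel_right, Finset.mul_sum]
    refine Finset.sum_congr rfl fun i _ => ?_
    rw [one_pow, C_eq_natCast]
    ring
  have hterm (i : ℕ) : bernoulliFunctional (C (j.choose i : ℝ) * X ^ (i + 1)) =
      (((j + 3).choose (i + 3) * bernoulli (i + 3) : ℚ) : ℝ) / ((j + 1) * (j + 2) * (j + 3)) := by
    have hchoose : ((j + 3).choose (i + 3) : ℝ) * ((i + 1) * (i + 2) * (i + 3)) =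
        (j + 1) * (j + 2) * (j + 3) * j.choose i := by exact_mod_cast add_three_choose_mul j i
    rw [bernoulliFunctional_C_mul_X_pow]
    push_cast
    field_simp
    linear_combination -(bernoulli (i + 3) : ℝ) * hchoose
  rw [hexpand, map_sum, Finset.sum_congr rfl fun i _ => hterm i, ← Finset.sum_div, ← Rat.cast_sum,
    sum_choose_mul_bernoulli, bernoulliIntegral_two_pow]
  push_cast
  field_simp
  ring

/-- This is the umbral form of the Euler-Maclaurin formula: the second Bernoulli polynomial is the
Peano kernel of the functional `F ↦ bernoulliFunctional (X * ΔF)`. -/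
theorem bernoulliFunctional_X_mul_forwardDiff (F : ℝ[X]) :
    bernoulliFunctional (X * (F.comp (X + 1) - F)) = -bernoulliIntegral 2 fun y => F.eval y := by
  induction F using Polynomial.induction_on' with
  | add p q hp hq =>
    simp only [eval_add, add_comp]
    rw [bernoulliIntegral_add 2 p.continuous q.continuous, neg_add, ← hp, ← hq, ← map_add,
      add_sub_add_comm, mul_add]
  | monomial j a =>
    simp only [eval_monomial, monomial_comp, ← smul_eq_mul (a := a)]
    rw [bernoulliIntegral_smul, ← smul_neg, ← bernoulliFunctional_X_mul_forwardDiff_X_pow,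
      ← map_smul, ← C_mul_X_pow_eq_monomial, ← smul_eq_C_mul, ← smul_eq_C_mul, ← smul_sub,
      mul_smul_comm]

theorem ascPochhammer_eq_sum_stirlingFirst {R : Type*} [CommRing R] [IsDomain R] [Infinite R]
    (k : ℕ) : ascPochhammer R k =
      ∑ l ∈ Finset.range (k + 1), C (Nat.stirlingFirst k l : R) * X ^ l :=
  Polynomial.funext fun x => by
    simp [ascPochhammer_eval_eq_sum_stirlingFirst, eval_finsetSum]

theorem neg_one_pow_mul_signedStirlingFirst (k l : ℕ) :
    (-1) ^ (k + l) * signedStirlingFirst k l = Nat.stirlingFirst k l := by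
  rw [signedStirlingFirst, ← mul_assoc, ← mul_pow, neg_one_mul, neg_neg, one_pow, one_mul]

theorem logSumNumer₁_eq_neg_bernoulliFunctional (k : ℕ) :
    (logSumNumer₁ k : ℝ) = -bernoulliFunctional (ascPochhammer ℝ k) := by
  rw [ascPochhammer_eq_sum_stirlingFirst, map_sum, Finset.sum_range_eq_add_Ico _ k.succ_pos,
    bernoulliFunctional_C_mul_X_pow, Nat.cast_zero, zero_mul, zero_mul, div_zero, zero_mul,
    zero_add, logSumNumer₁, Finset.mul_sum, ← Finset.sum_neg_distrib, Rat.cast_sum]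
  refine Finset.sum_congr rfl fun l _ => ?_
  have hsign : (-1 : ℝ) ^ (k + l) * signedStirlingFirst k l = Nat.stirlingFirst k l := by
    exact_mod_cast neg_one_pow_mul_signedStirlingFirst k l
  rw [bernoulliFunctional_C_mul_X_pow, ← hsign]
  push_cast
  ring

theorem logSumNumer₂_eq_neg_bernoulliFunctional (k : ℕ) :
    (logSumNumer₂ k : ℝ) = -bernoulliFunctional (X * ascPochhammer ℝ k) := by
  have hterm (l : ℕ) : bernoulliFunctional (X * (C (Nat.stirlingFirst k l : ℝ) * X ^ l)) =
      (bernoulli (l + 3) : ℝ) / ((l + 1) * (l + 2) * (l + 3)) *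
        ((-1) ^ (k + l) * signedStirlingFirst k l) := by
    have hsign : (-1 : ℝ) ^ (k + l) * signedStirlingFirst k l = Nat.stirlingFirst k l := by
      exact_mod_cast neg_one_pow_mul_signedStirlingFirst k l
    rw [mul_left_comm, ← pow_succ', bernoulliFunctional_C_mul_X_pow, hsign]
    push_cast
    ring
  rw [ascPochhammer_eq_sum_stirlingFirst, Finset.mul_sum, map_sum,
    Finset.sum_congr rfl fun l _ => hterm l, Finset.sum_range_eq_add_Ico _ k.succ_pos,
    bernoulli_eq_zero_of_odd (by decide) (by norm_num), Rat.cast_zero, zero_div, zero_mul,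
    zero_add, logSumNumer₂, Finset.mul_sum, ← Finset.sum_neg_distrib, Rat.cast_sum]
  refine Finset.sum_congr rfl fun l _ => ?_
  push_cast
  ring

theorem X_mul_forwardDiff_ascPochhammer {R : Type*} [CommRing R] (k : ℕ) :
    X * ((ascPochhammer R k).comp (X + 1) - ascPochhammer R k) =
      (k : R[X]) * ascPochhammer R k := by
  rw [mul_sub, ← ascPochhammer_succ_left, ascPochhammer_succ_right]
  ring

theorem natCast_mul_logSumNumer₁ (k : ℕ) :
    (k : ℝ) * logSumNumer₁ k = bernoulliIntegral 2 fun y => (ascPochhammer ℝ k).eval y := by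
  have h := bernoulliFunctional_X_mul_forwardDiff (ascPochhammer ℝ k)
  rw [X_mul_forwardDiff_ascPochhammer, ← nsmul_eq_mul, map_nsmul, nsmul_eq_mul] at h
  rw [logSumNumer₁_eq_neg_bernoulliFunctional, mul_neg, h, neg_neg]

theorem natCast_add_one_mul_logSumNumer₂ (k : ℕ) :
    ((k : ℝ) + 1) * logSumNumer₂ k =
      bernoulliIntegral 2 fun y => (y - 1) * (ascPochhammer ℝ k).eval y := by
  have hdiff : X * (((X - 1) * ascPochhammer ℝ k).comp (X + 1) - (X - 1) * ascPochhammer ℝ k) =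
      (k + 1) • (X * ascPochhammer ℝ k) := by
    simp only [mul_comp, sub_comp, X_comp, one_comp, nsmul_eq_mul, Nat.cast_add, Nat.cast_one]
    linear_combination X * X_mul_forwardDiff_ascPochhammer (R := ℝ) k
  have h := bernoulliFunctional_X_mul_forwardDiff ((X - 1) * ascPochhammer ℝ k)
  rw [hdiff, map_nsmul, nsmul_eq_mul, Nat.cast_add_one] at h
  simp only [eval_mul, eval_sub, eval_X, eval_one] at h
  rw [logSumNumer₂_eq_neg_bernoulliFunctional, mul_neg, h, neg_neg]

theorem logSumNumer₂_eq_sub (k : ℕ) :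
    (logSumNumer₂ k : ℝ) = logSumNumer₁ (k + 1) - k * logSumNumer₁ k := by
  simp only [logSumNumer₂_eq_neg_bernoulliFunctional, logSumNumer₁_eq_neg_bernoulliFunctional]
  rw [ascPochhammer_succ_right, mul_add, map_add, mul_comm _ X, mul_comm _ (k : ℝ[X]),
    ← nsmul_eq_mul, map_nsmul, nsmul_eq_mul]
  ring

theorem abs_logSumNumer₁_succ_le (k : ℕ) : |(logSumNumer₁ (k + 1) : ℝ)| ≤ k.factorial := by
  have h : ‖bernoulliIntegral 2 fun y => (ascPochhammer ℝ (k + 1)).eval y‖ ≤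
      1 * (k + 1).factorial :=
    norm_bernoulliIntegral_le (fun t ht => abs_bernoulliFun_two_div_le ht) fun t ht => by
      rw [Real.norm_of_nonneg (ascPochhammer_eval_nonneg _ ht.1), ← ascPochhammer_eval_one]
      exact ascPochhammer_eval_le _ ht.1 ht.2
  rw [← natCast_mul_logSumNumer₁, norm_mul, Real.norm_natCast, one_mul, Nat.factorial_succ,
    Nat.cast_mul] at h
  exact le_of_mul_le_mul_left h (Nat.cast_pos.2 k.succ_pos)

theorem abs_logSumNumer₂_succ_le (k : ℕ) : |(logSumNumer₂ (k + 1) : ℝ)| ≤ k.factorial := by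
  have h : ‖bernoulliIntegral 2 fun y => (y - 1) * (ascPochhammer ℝ (k + 1)).eval y‖ ≤
      1 * (k + 1).factorial :=
    norm_bernoulliIntegral_le (fun t ht => abs_bernoulliFun_two_div_le ht) fun t ht => by
      have hr := ascPochhammer_eval_nonneg (k + 1) ht.1
      have ht' : |t - 1| ≤ 1 := abs_le.2 ⟨by linarith [ht.1], by linarith [ht.2]⟩
      rw [norm_mul, Real.norm_of_nonneg hr, ← ascPochhammer_eval_one]
      exact (mul_le_of_le_one_left hr ht').trans (ascPochhammer_eval_le _ ht.1 ht.2)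
  rw [← natCast_add_one_mul_logSumNumer₂, norm_mul, ← Nat.cast_add_one, Real.norm_natCast, one_mul,
    Nat.factorial_succ, Nat.cast_mul] at h
  refine le_of_mul_le_mul_left (le_trans ?_ h) (Nat.cast_pos.2 k.succ_pos)
  exact mul_le_mul_of_nonneg_right (Nat.cast_le.2 (k + 1).le_succ) (abs_nonneg _)

end Numerators

section FactorialSeries

/-- The factorial series `∑ c_k / (x (x + 1) ⋯ (x + k - 1))` with the numerators
`c_k = logSumNumer₁ k`; the first series of the theorem is its value at `x = n + 1`. -/
noncomputable def logSumSeries (x : ℝ) : ℝ :=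
  ∑' k : ℕ, (logSumNumer₁ k : ℝ) / (ascPochhammer ℝ k).eval x

theorem logSumNumer₁_zero : logSumNumer₁ 0 = 0 := by
  simp [logSumNumer₁]

theorem logSumNumer₂_zero : logSumNumer₂ 0 = 0 := by
  simp [logSumNumer₂]

theorem norm_logSumNumer₁_succ_div_le {x : ℝ} (hx : 0 < x) (k : ℕ) :
    ‖(logSumNumer₁ (k + 1) : ℝ) / (ascPochhammer ℝ (k + 1)).eval x‖ ≤
      k.factorial / (ascPochhammer ℝ (k + 1)).eval x := by
  have hpos := ascPochhammer_pos (k + 1) x hx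
  rw [norm_div, Real.norm_of_nonneg hpos.le]
  exact div_le_div_of_nonneg_right (abs_logSumNumer₁_succ_le k) hpos.le

theorem summable_logSumNumer₁_div {x : ℝ} (hx : 1 < x) :
    Summable fun k : ℕ => (logSumNumer₁ k : ℝ) / (ascPochhammer ℝ k).eval x :=
  (summable_nat_add_iff 1).1 <| (hasSum_factorial_div_ascPochhammer hx).summable.of_norm_bounded
    (norm_logSumNumer₁_succ_div_le (zero_lt_one.trans hx))

theorem logSumSeries_eq_tsum_succ {x : ℝ} (hx : 1 < x) :
    logSumSeries x =
      ∑' k : ℕ, (logSumNumer₁ (k + 1) : ℝ) / (ascPochhammer ℝ (k + 1)).eval x := by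
  rw [logSumSeries, (summable_logSumNumer₁_div hx).tsum_eq_zero_add, logSumNumer₁_zero,
    Rat.cast_zero, zero_div, zero_add]

theorem norm_logSumSeries_le {x : ℝ} (hx : 1 < x) : ‖logSumSeries x‖ ≤ 1 / (x - 1) := by
  rw [logSumSeries_eq_tsum_succ hx]
  exact tsum_of_norm_bounded (hasSum_factorial_div_ascPochhammer hx)
    (norm_logSumNumer₁_succ_div_le (zero_lt_one.trans hx))

theorem tendsto_logSumSeries : Tendsto logSumSeries atTop (𝓝 0) := by
  refine squeeze_zero_norm' ?_
    (tendsto_inv_atTop_zero.comp (tendsto_atTop_add_const_right atTop (-1) tendsto_id))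
  filter_upwards [eventually_gt_atTop 1] with x hx
  simpa [sub_eq_add_neg] using norm_logSumSeries_le hx

theorem hasSum_bernoulliIntegral_one_div_sub {x : ℝ} (hx : 1 < x) :
    HasSum (fun k : ℕ => k * (logSumNumer₁ k : ℝ) / (ascPochhammer ℝ (k + 1)).eval x)
      (bernoulliIntegral 2 fun y => 1 / (x - y)) := by
  have h := hasSum_bernoulliIntegral 2
    (F := fun k y => ((ascPochhammer ℝ (k + 1)).eval x)⁻¹ • (ascPochhammer ℝ k).eval y)
    (fun k => by fun_prop)
    (hasSum_factorial_div_ascPochhammer hx).summable (fun k y hy => ?_)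
    (fun y hy => (hasSum_ascPochhammer_div hy.1 (hy.2.trans_lt hx)).congr_fun fun k => ?_)
  · simp only [bernoulliIntegral_smul, ← natCast_mul_logSumNumer₁] at h
    simpa only [smul_eq_mul, inv_mul_eq_div] using h
  · have hpos := ascPochhammer_pos (k + 1) x (zero_lt_one.trans hx)
    rw [smul_eq_mul, inv_mul_eq_div, norm_div, Real.norm_of_nonneg hpos.le,
      Real.norm_of_nonneg (ascPochhammer_eval_nonneg k hy.1.le), ← ascPochhammer_eval_one]
    exact div_le_div_of_nonneg_right (ascPochhammer_eval_le k hy.1.le hy.2) hpos.le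
  · rw [smul_eq_mul, inv_mul_eq_div]

theorem logSumSeries_sub_logSumSeries_add_one {x : ℝ} (hx : 1 < x) :
    logSumSeries x - logSumSeries (x + 1) = bernoulliIntegral 2 fun y => 1 / (x - y) := by
  have hx' : 1 < x + 1 := by linarith
  rw [← (hasSum_bernoulliIntegral_one_div_sub hx).tsum_eq, logSumSeries, logSumSeries,
    ← (summable_logSumNumer₁_div hx).tsum_sub (summable_logSumNumer₁_div hx')]
  refine tsum_congr fun k => ?_
  have hpos : 0 < (ascPochhammer ℝ k).eval x := ascPochhammer_pos k x (by linarith)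
  have hpos' : 0 < (ascPochhammer ℝ k).eval (x + 1) := ascPochhammer_pos k _ (by linarith)
  have hshift : x * (ascPochhammer ℝ k).eval (x + 1) = (ascPochhammer ℝ k).eval x * (x + k) := by
    rw [mul_ascPochhammer_eval_add_one, ascPochhammer_succ_eval]
  rw [ascPochhammer_succ_eval, ← hshift]
  field_simp
  linear_combination (logSumNumer₁ k : ℝ) * hshift

theorem tendsto_logSumNumer₁_div {x : ℝ} (hx : 0 < x) :
    Tendsto (fun k : ℕ => (logSumNumer₁ k : ℝ) / (ascPochhammer ℝ k).eval x) atTop (𝓝 0) := by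
  rw [← tendsto_add_atTop_iff_nat 1]
  have h := (tendsto_ascPochhammer_div zero_lt_one (lt_add_of_pos_left 1 hx)).const_mul x⁻¹
  rw [mul_zero] at h
  refine squeeze_zero_norm (fun k => ?_) h
  refine (norm_logSumNumer₁_succ_div_le hx k).trans_eq ?_
  rw [ascPochhammer_eval_one, ← mul_ascPochhammer_eval_add_one, div_mul_eq_div_div_swap,
    inv_mul_eq_div]

theorem summable_logSumNumer₂_div {x : ℝ} (hx : 0 < x) :
    Summable fun k : ℕ => (logSumNumer₂ k : ℝ) / (ascPochhammer ℝ (k + 1)).eval x := by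
  rw [← summable_nat_add_iff 1]
  refine ((hasSum_factorial_div_ascPochhammer (lt_add_of_pos_left 1 hx)).summable.mul_left
    x⁻¹).of_norm_bounded fun k => ?_
  have hpos := ascPochhammer_pos (k + 1 + 1) x hx
  rw [norm_div, Real.norm_of_nonneg hpos.le, inv_mul_eq_div, ← div_mul_eq_div_div_swap,
    mul_ascPochhammer_eval_add_one]
  exact div_le_div_of_nonneg_right (abs_logSumNumer₂_succ_le k) hpos.le

theorem logSumNumer₂_div_eq {x : ℝ} (hx : 0 < x) (k : ℕ) :
    (logSumNumer₂ k : ℝ) / (ascPochhammer ℝ (k + 1)).eval x =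
      (logSumNumer₁ k : ℝ) / (ascPochhammer ℝ k).eval (x + 1) +
        ((logSumNumer₁ (k + 1) : ℝ) / (ascPochhammer ℝ (k + 1)).eval x -
          (logSumNumer₁ k : ℝ) / (ascPochhammer ℝ k).eval x) := by
  have hxk : x + k ≠ 0 := by positivity
  have hpos : 0 < (ascPochhammer ℝ k).eval x := ascPochhammer_pos k x hx
  have hshift : (ascPochhammer ℝ k).eval (x + 1) = (ascPochhammer ℝ k).eval x * (x + k) / x := by
    rw [eq_div_iff hx.ne', mul_comm, mul_ascPochhammer_eval_add_one, ascPochhammer_succ_eval]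
  rw [logSumNumer₂_eq_sub, ascPochhammer_succ_eval, hshift]
  field_simp
  ring

theorem hasSum_logSumNumer₂_div {x : ℝ} (hx : 0 < x) :
    HasSum (fun k : ℕ => (logSumNumer₂ k : ℝ) / (ascPochhammer ℝ (k + 1)).eval x)
      (logSumSeries (x + 1)) := by
  have htelescope (K : ℕ) :=
    Finset.sum_range_sub (fun k => (logSumNumer₁ k : ℝ) / (ascPochhammer ℝ k).eval x) K
  refine (summable_logSumNumer₂_div hx).hasSum_iff_tendsto_nat.2 ?_
  simp only [logSumNumer₂_div_eq hx, Finset.sum_add_distrib, htelescope, logSumNumer₁_zero,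
    Rat.cast_zero, zero_div, sub_zero]
  rw [← add_zero (logSumSeries _)]
  exact (summable_logSumNumer₁_div (lt_add_of_pos_left 1 hx)).hasSum.tendsto_sum_nat.add
    (tendsto_logSumNumer₁_div hx)

theorem logSumTerm₁_eq (n k : ℕ) :
    logSumTerm₁ n k = logSumNumer₁ k / (ascPochhammer ℝ k).eval ((n : ℝ) + 1) := by
  have h := Finset.prod_Ico_add' (fun j : ℕ => (n : ℝ) + j) 0 k 1
  rw [logSumTerm₁, ascPochhammer_eval_eq_prod_range, Finset.range_eq_Ico,
    ← Finset.Ico_add_one_right_eq_Icc, ← zero_add 1, ← h]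
  simp only [Nat.cast_add, Nat.cast_one, add_assoc, add_comm (1 : ℝ)]

theorem logSumTerm₂_eq (n k : ℕ) :
    logSumTerm₂ n k = logSumNumer₂ k / (ascPochhammer ℝ (k + 1)).eval (n : ℝ) := by
  rw [logSumTerm₂, ascPochhammer_eval_eq_prod_range, Finset.range_eq_Ico]
  rfl

theorem hasSum_logSumTerm₁ {n : ℕ} (hn : 1 ≤ n) :
    HasSum (fun k => logSumTerm₁ n (k + 1)) (logSumSeries (n + 1)) := by
  have h := (hasSum_nat_add_iff' 1).2
    (summable_logSumNumer₁_div (lt_add_of_pos_left 1 (Nat.cast_pos.2 hn))).hasSum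
  simpa [logSumTerm₁_eq, logSumNumer₁_zero, logSumSeries] using h

theorem hasSum_logSumTerm₂ {n : ℕ} (hn : 1 ≤ n) :
    HasSum (fun k => logSumTerm₂ n (k + 1)) (logSumSeries (n + 1)) := by
  have h := (hasSum_nat_add_iff' 1).2 (hasSum_logSumNumer₂_div (Nat.cast_pos.2 hn))
  simpa [logSumTerm₂_eq, logSumNumer₂_zero] using h

end FactorialSeries

section Zeta

open Complex

theorem hasDerivAt_ofReal_add_cpow {x y : ℝ} (h : 0 < x + y) (a : ℂ) :
    HasDerivAt (fun t : ℝ => ((x : ℂ) + t) ^ a) (a * ((x : ℂ) + y) ^ (a - 1)) y := by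
  have hadd : HasDerivAt (fun z : ℂ => (x : ℂ) + z) 1 (y : ℂ) := (hasDerivAt_id _).const_add _
  have hmem : (x : ℂ) + y ∈ slitPlane := by
    rw [← ofReal_add]
    exact ofReal_mem_slitPlane.2 h
  simpa using (hadd.cpow_const (c := a) hmem).comp_ofReal

/-- The terms `z^{1-s} / (1-s) + z^{-s} / 2 - s z^{-s-1} / 12` of the Euler-Maclaurin expansion of
`∑_{k ≤ z} k^{-s}`. -/
noncomputable def zetaMain (z s : ℂ) : ℂ :=
  z ^ (1 - s) / (1 - s) + z ^ (-s) / 2 - s / 12 * z ^ (-s - 1)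

theorem cpow_neg_sub_zetaMain_sub {x : ℝ} (hx : 0 < x) {s : ℂ} (hs : s ≠ 1) :
    ((x : ℂ) + 1) ^ (-s) - (zetaMain (x + 1) s - zetaMain x s) =
      bernoulliIntegral 3 fun t : ℝ => -(s * (s + 1) * (s + 2)) * ((x : ℂ) + t) ^ (-s - 3) := by
  have hs' : 1 - s ≠ 0 := sub_ne_zero.2 hs.symm
  have hderiv (a : ℂ) (t : ℝ) (ht : t ∈ Set.Icc (0 : ℝ) 1) :=
    hasDerivAt_ofReal_add_cpow (add_pos_of_pos_of_nonneg hx ht.1) a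
  have hF (t : ℝ) (ht : t ∈ Set.Icc (0 : ℝ) 1) :
      HasDerivAt (fun t : ℝ => ((x : ℂ) + t) ^ (1 - s) / (1 - s)) (((x : ℂ) + t) ^ (-s)) t :=
    ((hderiv (1 - s) t ht).div_const (1 - s)).congr_deriv <| by
      rw [mul_div_cancel_left₀ _ hs', show 1 - s - 1 = -s by ring]
  have hf (t : ℝ) (ht : t ∈ Set.Icc (0 : ℝ) 1) :
      HasDerivAt (fun t : ℝ => ((x : ℂ) + t) ^ (-s)) (-s * ((x : ℂ) + t) ^ (-s - 1)) t :=
    hderiv (-s) t ht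
  have hg (t : ℝ) (ht : t ∈ Set.Icc (0 : ℝ) 1) :
      HasDerivAt (fun t : ℝ => -s * ((x : ℂ) + t) ^ (-s - 1))
        (s * (s + 1) * ((x : ℂ) + t) ^ (-s - 2)) t :=
    ((hderiv (-s - 1) t ht).const_mul (-s)).congr_deriv <| by
      rw [show -s - 1 - 1 = -s - 2 by ring]
      ring
  have hh (t : ℝ) (ht : t ∈ Set.Icc (0 : ℝ) 1) :
      HasDerivAt (fun t : ℝ => s * (s + 1) * ((x : ℂ) + t) ^ (-s - 2))
        (-(s * (s + 1) * (s + 2)) * ((x : ℂ) + t) ^ (-s - 3)) t :=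
    ((hderiv (-s - 2) t ht).const_mul (s * (s + 1))).congr_deriv <| by
      rw [show -s - 2 - 1 = -s - 3 by ring]
      ring
  have hh' : ContinuousOn
      (fun t : ℝ => -(s * (s + 1) * (s + 2)) * ((x : ℂ) + t) ^ (-s - 3)) (Set.Icc 0 1) :=
    fun t ht => ((hderiv (-s - 3) t ht).const_mul _).continuousAt.continuousWithinAt
  rw [bernoulliIntegral_three hh hh']
  have hEM := eulerMaclaurin_two hF hf hg fun t ht => (hh t ht).continuousAt.continuousWithinAt
  simp only [ofReal_one, ofReal_zero, add_zero, real_smul] at hEM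
  push_cast at hEM
  rw [zetaMain, zetaMain]
  linear_combination hEM

theorem norm_cpow_neg_sub_zetaMain_sub_le {x : ℝ} (hx : 0 < x) {s : ℂ} (hs : s ≠ 1)
    (hre : -3 ≤ s.re) :
    ‖((x : ℂ) + 1) ^ (-s) - (zetaMain (x + 1) s - zetaMain x s)‖ ≤
      ‖s * (s + 1) * (s + 2)‖ * x ^ (-s.re - 3) := by
  rw [cpow_neg_sub_zetaMain_sub hx hs, ← one_mul (‖_‖ * _)]
  refine norm_bernoulliIntegral_le (fun t ht => abs_bernoulliFun_three_div_le ht) fun t ht => ?_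
  have hpos : 0 < x + t := add_pos_of_pos_of_nonneg hx ht.1
  rw [norm_mul, norm_neg, ← ofReal_add, norm_cpow_eq_rpow_re_of_pos hpos, sub_re, neg_re, re_ofNat]
  exact mul_le_mul_of_nonneg_left
    (Real.rpow_le_rpow_of_nonpos hx (le_add_of_nonneg_right ht.1) (by linarith)) (norm_nonneg _)

/-- The partial sum `∑_{k ≤ N} k^{-s}` corrected by its Euler-Maclaurin terms, an approximation of
`ζ s` which converges for `-2 < re s`. -/
noncomputable def zetaApprox (N : ℕ) (s : ℂ) : ℂ :=
  ∑ k ∈ Finset.Icc 1 N, (k : ℂ) ^ (-s) - zetaMain N s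

theorem norm_zetaApprox_succ_sub_le {N : ℕ} (hN : N ≠ 0) {s : ℂ} (hs : s ≠ 1) (hre : -3 ≤ s.re) :
    ‖zetaApprox (N + 1) s - zetaApprox N s‖ ≤
      ‖s * (s + 1) * (s + 2)‖ * (N : ℝ) ^ (-s.re - 3) := by
  refine le_of_eq_of_le (congrArg norm ?_)
    (norm_cpow_neg_sub_zetaMain_sub_le (Nat.cast_pos.2 (Nat.pos_of_ne_zero hN)) hs hre)
  rw [zetaApprox, zetaApprox, Finset.sum_Icc_succ_top (Nat.le_add_left 1 N)]
  push_cast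
  ring

theorem differentiableAt_zetaMain {z s : ℂ} (hz : z ≠ 0) (hs : s ≠ 1) :
    DifferentiableAt ℂ (zetaMain z) s := by
  have hs' : 1 - s ≠ 0 := sub_ne_zero.2 hs.symm
  unfold zetaMain
  fun_prop (disch := first | assumption | exact Or.inl hz)

theorem differentiableAt_zetaApprox {N : ℕ} (hN : N ≠ 0) {s : ℂ} (hs : s ≠ 1) :
    DifferentiableAt ℂ (zetaApprox N) s := by
  refine (DifferentiableAt.fun_sum fun k hk => ?_).sub
    (differentiableAt_zetaMain (Nat.cast_ne_zero.2 hN) hs)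
  have hk' : (k : ℂ) ≠ 0 := Nat.cast_ne_zero.2 (Nat.one_le_iff_ne_zero.1 (Finset.mem_Icc.1 hk).1)
  exact differentiableAt_id.neg.const_cpow (Or.inl hk')

theorem tendsto_natCast_cpow_atTop {a : ℂ} (ha : a.re < 0) :
    Tendsto (fun N : ℕ => (N : ℂ) ^ a) atTop (𝓝 0) := by
  rw [tendsto_zero_iff_norm_tendsto_zero]
  refine ((tendsto_rpow_neg_atTop (neg_pos.2 ha)).comp tendsto_natCast_atTop_atTop).congr' ?_
  filter_upwards [eventually_gt_atTop 0] with N hN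
  rw [norm_natCast_cpow_of_pos hN, neg_neg, Function.comp_apply]

theorem tendsto_zetaMain {s : ℂ} (hs : 1 < s.re) :
    Tendsto (fun N : ℕ => zetaMain N s) atTop (𝓝 0) := by
  have h1 := (tendsto_natCast_cpow_atTop (a := 1 - s) (by simpa using hs)).div_const (1 - s)
  have h2 := (tendsto_natCast_cpow_atTop (a := -s) (by rw [neg_re]; linarith)).div_const 2
  have h3 := (tendsto_natCast_cpow_atTop (a := -s - 1)
    (by rw [sub_re, neg_re, one_re]; linarith)).const_mul (s / 12)
  simpa [zetaMain] using (h1.add h2).sub h3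

theorem tendsto_zetaApprox_of_one_lt_re {s : ℂ} (hs : 1 < s.re) :
    Tendsto (fun N => zetaApprox N s) atTop (𝓝 (riemannZeta s)) := by
  have hs0 : s ≠ 0 := by rintro rfl; norm_num at hs
  have hsum : HasSum (fun k : ℕ => (k : ℂ) ^ (-s)) (riemannZeta s) := by
    rw [zeta_eq_tsum_one_div_nat_cpow hs]
    simpa only [cpow_neg, one_div] using (summable_one_div_nat_cpow.2 hs).hasSum
  have hlim := (tendsto_add_atTop_iff_nat 1).2 hsum.tendsto_sum_nat
  rw [← sub_zero (riemannZeta s)]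
  refine (hlim.sub (tendsto_zetaMain hs)).congr fun N => ?_
  rw [zetaApprox, Finset.sum_range_eq_add_Ico _ N.succ_pos, Nat.succ_eq_add_one,
    Finset.Ico_add_one_right_eq_Icc, Nat.cast_zero, zero_cpow (neg_ne_zero.2 hs0), zero_add]

/-- The punctured half-plane `-2 < re s`, `s ≠ 1`, on which the approximations `zetaApprox`
converge. -/
def zetaDomain : Set ℂ := {s | -2 < s.re} \ {1}

theorem isOpen_zetaDomain : IsOpen zetaDomain :=
  (isOpen_lt continuous_const continuous_re).sdiff isClosed_singleton

theorem isPreconnected_setOf_lt_re_diff_singleton {a : ℝ} {w : ℂ} (hw : a < w.re) :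
    IsPreconnected ({s : ℂ | a < s.re} \ {w}) := by
  let φ : ℂ → ℂ := fun z => (a + Real.exp z.re : ℝ) + z.im * I
  have hre (z : ℂ) : (φ z).re = a + Real.exp z.re := by
    simp only [φ, add_re, ofReal_re, re_ofReal_mul, I_re, mul_zero, add_zero]
  have him (z : ℂ) : (φ z).im = z.im := by
    simp only [φ, add_im, ofReal_im, im_ofReal_mul, I_im, mul_one, zero_add]
  have hφ : Function.Injective φ := fun z z' h => Complex.ext
    (Real.exp_injective <| add_left_cancel <| by rw [← hre z, ← hre z', h])
    (by rw [← him z, ← him z', h])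
  have hsurj (s : ℂ) (hs : a < s.re) : φ ⟨Real.log (s.re - a), s.im⟩ = s :=
    Complex.ext (by rw [hre, Real.exp_log (sub_pos.2 hs), add_sub_cancel]) (him _)
  have himage : φ '' {⟨Real.log (w.re - a), w.im⟩}ᶜ = {s : ℂ | a < s.re} \ {w} := by
    rw [Set.image_compl_eq_range_sdiff_image hφ, Set.image_singleton, hsurj w hw]
    congr 1
    ext s
    refine ⟨?_, fun hs => ⟨_, hsurj s hs⟩⟩
    rintro ⟨z, rfl⟩
    rw [Set.mem_ofPred_eq, hre]
    exact lt_add_of_pos_right a (Real.exp_pos _)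
  rw [← himage]
  exact (isConnected_compl_singleton_of_one_lt_rank (by simp) _).isPreconnected.image φ
    (by fun_prop)

theorem neg_one_mem_zetaDomain : (-1 : ℂ) ∈ zetaDomain := by
  norm_num [zetaDomain]

theorem exists_norm_zetaApprox_succ_sub_le {K : Set ℂ} (hK : IsCompact K) (hKU : K ⊆ zetaDomain) :
    ∃ u : ℕ → ℝ, Summable u ∧
      ∀ N, ∀ s ∈ K, ‖zetaApprox (N + 1 + 1) s - zetaApprox (N + 1) s‖ ≤ u N := by
  obtain rfl | hne := K.eq_empty_or_nonempty
  · exact ⟨0, summable_zero, by simp⟩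
  obtain ⟨s₀, hs₀, hmin⟩ := hK.exists_isMinOn hne continuous_re.continuousOn
  obtain ⟨C, hC⟩ := hK.exists_bound_of_continuousOn
    (f := fun s : ℂ => s * (s + 1) * (s + 2)) (by fun_prop)
  have hre₀ : -2 < s₀.re := (hKU hs₀).1
  refine ⟨fun N => C * ((N + 1 : ℕ) : ℝ) ^ (-s₀.re - 3), Summable.mul_left _ <|
    (summable_nat_add_iff 1).2 (Real.summable_nat_rpow.2 (by linarith)), fun N s hs => ?_⟩
  have hre : s₀.re ≤ s.re := hmin hs
  refine (norm_zetaApprox_succ_sub_le N.succ_ne_zero (hKU hs).2 (by linarith)).trans ?_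
  exact mul_le_mul (hC s hs)
    (Real.rpow_le_rpow_of_exponent_le (Nat.one_le_cast.2 N.succ_pos) (by linarith))
    (by positivity) ((norm_nonneg _).trans (hC s hs))

theorem exists_tendstoLocallyUniformlyOn_zetaApprox :
    ∃ f : ℂ → ℂ, TendstoLocallyUniformlyOn (fun N => zetaApprox (N + 1)) f atTop zetaDomain := by
  refine ⟨fun s => zetaApprox 1 s + ∑' N, (zetaApprox (N + 1 + 1) s - zetaApprox (N + 1) s),
    (tendstoLocallyUniformlyOn_iff_forall_isCompact isOpen_zetaDomain).2 fun K hKU hK => ?_⟩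
  obtain ⟨u, hu, hle⟩ := exists_norm_zetaApprox_succ_sub_le hK hKU
  have h := Metric.tendstoUniformlyOn_iff.1 (tendstoUniformlyOn_tsum_nat hu hle)
  refine Metric.tendstoUniformlyOn_iff.2 fun ε hε => (h ε hε).mono fun N hN s hs => ?_
  have htelescope := Finset.sum_range_sub (fun N => zetaApprox (N + 1) s) N
  rw [add_comm, ← sub_add_cancel (zetaApprox (N + 1) s) (zetaApprox 1 s), dist_add_right,
    ← htelescope]
  exact hN s hs

theorem tendstoLocallyUniformlyOn_zetaApprox :
    TendstoLocallyUniformlyOn (fun N => zetaApprox (N + 1)) riemannZeta atTop zetaDomain := by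
  obtain ⟨f, hf⟩ := exists_tendstoLocallyUniformlyOn_zetaApprox
  refine hf.congr_right ?_
  have hdiff : DifferentiableOn ℂ f zetaDomain :=
    hf.differentiableOn (Eventually.of_forall fun N s hs =>
      (differentiableAt_zetaApprox N.succ_ne_zero hs.2).differentiableWithinAt) isOpen_zetaDomain
  have hζ : DifferentiableOn ℂ riemannZeta zetaDomain := fun s hs =>
    (differentiableAt_riemannZeta hs.2).differentiableWithinAt
  have htwo : (2 : ℂ) ∈ zetaDomain := by norm_num [zetaDomain]
  refine (hdiff.analyticOnNhd isOpen_zetaDomain).eqOn_of_preconnected_of_eventuallyEq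
    (hζ.analyticOnNhd isOpen_zetaDomain)
    (isPreconnected_setOf_lt_re_diff_singleton (by norm_num)) htwo ?_
  filter_upwards [isOpen_zetaDomain.mem_nhds htwo,
    (isOpen_lt continuous_const continuous_re).mem_nhds
      (show (1 : ℝ) < (2 : ℂ).re by norm_num)] with s hs hre
  exact tendsto_nhds_unique (hf.tendsto_at hs)
    ((tendsto_zetaApprox_of_one_lt_re hre).comp (tendsto_add_atTop_nat 1))

theorem hasDerivAt_zetaMain {N : ℕ} (hN : N ≠ 0) :
    HasDerivAt (zetaMain N) (-(logSumMain N : ℂ)) (-1) := by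
  have hN' : (N : ℂ) ≠ 0 := Nat.cast_ne_zero.2 hN
  have hid := hasDerivAt_id (-1 : ℂ)
  have d1 := ((hid.const_sub 1).const_cpow (Or.inl hN')).div (hid.const_sub 1) (by norm_num)
  have d2 := (hid.neg.const_cpow (Or.inl hN')).div_const 2
  have d3 := (hid.div_const 12).mul ((hid.neg.sub_const 1).const_cpow (Or.inl hN'))
  refine ((d1.add d2).sub d3).congr_deriv ?_
  have htwo : (1 : ℂ) - -1 = (2 : ℕ) := by norm_num
  simp only [id, Pi.neg_apply, neg_neg, sub_self, cpow_zero, cpow_one, htwo, cpow_natCast]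
  rw [logSumMain]
  push_cast
  ring

/-- The difference between `∑_{k ≤ n} k log k` and its elementary part. -/
noncomputable def logSumRemainder (n : ℕ) : ℝ :=
  ∑ k ∈ Finset.range (n + 1), (k : ℝ) * Real.log k - logSumMain n

theorem hasDerivAt_zetaApprox {N : ℕ} (hN : N ≠ 0) :
    HasDerivAt (zetaApprox N) (-(logSumRemainder N : ℂ)) (-1) := by
  have hterm (k : ℕ) (hk : k ∈ Finset.Icc 1 N) :
      HasDerivAt (fun s : ℂ => (k : ℂ) ^ (-s)) (-((k : ℝ) * Real.log k : ℝ)) (-1) := by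
    have hk' : (k : ℂ) ≠ 0 := Nat.cast_ne_zero.2 (Nat.one_le_iff_ne_zero.1 (Finset.mem_Icc.1 hk).1)
    refine ((hasDerivAt_id (-1 : ℂ)).neg.const_cpow (Or.inl hk')).congr_deriv ?_
    simp
  refine ((HasDerivAt.fun_sum hterm).sub (hasDerivAt_zetaMain hN)).congr_deriv ?_
  rw [logSumRemainder, Finset.sum_range_eq_add_Ico _ N.succ_pos, Nat.succ_eq_add_one,
    Finset.Ico_add_one_right_eq_Icc, Nat.cast_zero, zero_mul, zero_add, Finset.sum_neg_distrib]
  push_cast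
  ring

theorem tendsto_logSumRemainder :
    Tendsto (fun N => (logSumRemainder N : ℂ)) atTop (𝓝 (-deriv riemannZeta (-1))) := by
  have h := (tendstoLocallyUniformlyOn_zetaApprox.deriv (Eventually.of_forall fun N s hs =>
    (differentiableAt_zetaApprox N.succ_ne_zero hs.2).differentiableWithinAt)
    isOpen_zetaDomain).tendsto_at neg_one_mem_zetaDomain
  rw [← tendsto_add_atTop_iff_nat 1]
  refine h.neg.congr fun N => ?_
  rw [Function.comp_apply, (hasDerivAt_zetaApprox N.succ_ne_zero).deriv, neg_neg]

end Zeta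

section Conclusion

theorem add_one_mul_log_add_one {x : ℝ} (hx : 0 < x) :
    (x + 1) * Real.log (x + 1) =
      (1 / 2 * (x + 1) ^ 2 * Real.log (x + 1) - 1 / 4 * (x + 1) ^ 2 +
        1 / 2 * (x + 1) * Real.log (x + 1) + 1 / 12 * Real.log (x + 1)) -
      (1 / 2 * x ^ 2 * Real.log x - 1 / 4 * x ^ 2 + 1 / 2 * x * Real.log x +
        1 / 12 * Real.log x) - bernoulliIntegral 2 fun t => 1 / (x + t) := by
  have hadd (t : ℝ) : HasDerivAt (fun t => x + t) 1 t := (hasDerivAt_id t).const_add x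
  have hpos {t : ℝ} (ht : t ∈ Set.Icc (0 : ℝ) 1) : x + t ≠ 0 :=
    (add_pos_of_pos_of_nonneg hx ht.1).ne'
  have hlog (t : ℝ) (ht : t ∈ Set.Icc (0 : ℝ) 1) :
      HasDerivAt (fun t => Real.log (x + t)) (1 / (x + t)) t := (hadd t).log (hpos ht)
  have h := eulerMaclaurin_two
    (F := fun t => 1 / 2 * ((x + t) ^ 2 * Real.log (x + t)) - 1 / 4 * (x + t) ^ 2)
    (f := fun t => (x + t) * Real.log (x + t))
    (g := fun t => Real.log (x + t) + 1)
    (h := fun t => 1 / (x + t))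
    (fun t ht => (((((hadd t).fun_pow 2).fun_mul (hlog t ht)).const_mul (1 / 2)).fun_sub
      (((hadd t).fun_pow 2).const_mul (1 / 4))).congr_deriv
        (by have hne := hpos ht; push_cast; field_simp; ring))
    (fun t ht => ((hadd t).fun_mul (hlog t ht)).congr_deriv
      (by have hne := hpos ht; field_simp))
    (fun t ht => (hlog t ht).add_const 1)
    (continuousOn_const.div (by fun_prop) fun t ht => hpos ht)
  simp only [add_zero, smul_eq_mul] at h
  linear_combination h

theorem logSumRemainder_succ_sub {n : ℕ} (hn : 1 ≤ n) :
    logSumRemainder (n + 1) - logSumRemainder n =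
      logSumSeries ((n + 1 : ℕ) + 1) - logSumSeries (n + 1) := by
  have hn' : (0 : ℝ) < n := Nat.cast_pos.2 hn
  have hEM := add_one_mul_log_add_one hn'
  have hseries := logSumSeries_sub_logSumSeries_add_one (lt_add_of_pos_left 1 hn')
  have hreflect := bernoulliIntegral_comp_one_sub 2 fun t => 1 / ((n : ℝ) + t)
  simp only [even_two, Even.neg_pow, one_pow, one_smul, ← add_sub_assoc] at hreflect
  rw [hreflect] at hseries
  rw [logSumRemainder, logSumRemainder, Finset.sum_range_succ _ (n + 1), logSumMain, logSumMain]
  push_cast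
  linear_combination hEM + hseries

theorem logSumRemainder_eq {n : ℕ} (hn : 1 ≤ n) :
    (logSumRemainder n : ℂ) = -deriv riemannZeta (-1) + logSumSeries (n + 1) := by
  have hconst (m : ℕ) (hm : n ≤ m) : logSumRemainder m - logSumSeries (m + 1) =
      logSumRemainder n - logSumSeries (n + 1) := by
    induction m, hm using Nat.le_induction with
    | base => rfl
    | succ m hm ih => linear_combination ih + logSumRemainder_succ_sub (hn.trans hm)
  have hseries : Tendsto (fun m : ℕ => (logSumSeries (m + 1) : ℂ)) atTop (𝓝 0) := by
    have h := tendsto_logSumSeries.comp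
      (tendsto_natCast_atTop_atTop.atTop_add (tendsto_const_nhds (x := (1 : ℝ))))
    exact_mod_cast (Complex.continuous_ofReal.tendsto 0).comp h
  have hlim := tendsto_logSumRemainder.sub hseries
  have heq := tendsto_nhds_unique hlim <| tendsto_const_nhds.congr' <| by
    filter_upwards [eventually_ge_atTop n] with m hm
    rw [← Complex.ofReal_sub, hconst m hm]
  push_cast at heq
  linear_combination -heq

theorem sum_mul_log_eq_add_of_hasSum {n : ℕ} (hn : 1 ≤ n) {f : ℕ → ℝ}
    (hf : HasSum f (logSumSeries (n + 1))) :
    ((∑ k ∈ Finset.range (n + 1), (k : ℝ) * Real.log k : ℝ) : ℂ) =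
      (logSumMain n : ℂ) - deriv riemannZeta (-1) + ((∑' k, f k : ℝ) : ℂ) := by
  have h := logSumRemainder_eq hn
  rw [logSumRemainder, Complex.ofReal_sub] at h
  rw [hf.tsum_eq]
  linear_combination h

theorem bernoulli_four : bernoulli 4 = -1 / 30 := by
  rw [bernoulli_eq_bernoulli'_of_ne_one (by norm_num), bernoulli'_four]

theorem bernoulli_six : bernoulli 6 = 1 / 42 := by
  have h := sum_bernoulli 7
  norm_num [Finset.sum_range_succ, bernoulli_two, bernoulli_four, bernoulli_eq_zero_of_odd,
    Nat.odd_iff, Nat.choose] at h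
  linarith

theorem logSumNumer₁_values :
    logSumNumer₁ 1 = 0 ∧ logSumNumer₁ 2 = 1 / 720 ∧ logSumNumer₁ 3 = 1 / 240 ∧
      logSumNumer₁ 4 = 19 / 1260 ∧ logSumNumer₁ 5 = 17 / 252 := by
  norm_num [logSumNumer₁, Finset.sum_Icc_succ_top, signedStirlingFirst, Nat.stirlingFirst,
    bernoulli_four, bernoulli_six, bernoulli_eq_zero_of_odd, Nat.odd_iff]

theorem logSumNumer₂_values :
    logSumNumer₂ 1 = 1 / 720 ∧ logSumNumer₂ 2 = 1 / 720 ∧ logSumNumer₂ 3 = 13 / 5040 ∧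
      logSumNumer₂ 4 = 1 / 140 := by
  norm_num [logSumNumer₂, Finset.sum_Icc_succ_top, signedStirlingFirst, Nat.stirlingFirst,
    bernoulli_four, bernoulli_six, bernoulli_eq_zero_of_odd, Nat.odd_iff]

end Conclusion

theorem mainTheorem8 :
    (∀ n : ℕ, 1 ≤ n →
      (Summable (fun k : ℕ => logSumTerm₁ n (k + 1)) ∧
        ((∑ k ∈ Finset.range (n + 1), (k : ℝ) * Real.log k : ℝ) : ℂ) =
          (logSumMain n : ℂ) - deriv riemannZeta (-1)
            + ((∑' k : ℕ, logSumTerm₁ n (k + 1) : ℝ) : ℂ)) ∧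
      (Summable (fun k : ℕ => logSumTerm₂ n (k + 1)) ∧
        ((∑ k ∈ Finset.range (n + 1), (k : ℝ) * Real.log k : ℝ) : ℂ) =
          (logSumMain n : ℂ) - deriv riemannZeta (-1)
            + ((∑' k : ℕ, logSumTerm₂ n (k + 1) : ℝ) : ℂ))) ∧
    (logSumNumer₁ 1 = 0 ∧ logSumNumer₁ 2 = 1 / 720 ∧ logSumNumer₁ 3 = 1 / 240 ∧
      logSumNumer₁ 4 = 19 / 1260 ∧ logSumNumer₁ 5 = 17 / 252) ∧
    (logSumNumer₂ 1 = 1 / 720 ∧ logSumNumer₂ 2 = 1 / 720 ∧ logSumNumer₂ 3 = 13 / 5040 ∧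
      logSumNumer₂ 4 = 1 / 140) := by
  refine ⟨fun n hn => ?_, logSumNumer₁_values, logSumNumer₂_values⟩
  have h₁ := hasSum_logSumTerm₁ hn
  have h₂ := hasSum_logSumTerm₂ hn
  exact ⟨⟨h₁.summable, sum_mul_log_eq_add_of_hasSum hn h₁⟩,
    h₂.summable, sum_mul_log_eq_add_of_hasSum hn h₂⟩
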